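/- Let $k$ be a field, $G$ a finite group whose order is invertible in $k$, and let $H$ be one of the Hopf algebras $kG$ or $(kG)^*$. Let $R$ be a unital $k$-algebra which is a twisted $H$-module algebra with unital crossed product, i.e. there are a $k$-linear map $H\otimes R\to R$, $h\otimes r\mapsto h\cdot r$, with $1\cdot r=r$ and $h\cdot(rs)=\sum(h_1\cdot r)(h_2\cdot s)$, and a convolution-invertible $k$-linear map $\sigma:H\otimes H\to R$ with $$h\cdot(l\cdot r)=\sum\sigma(h_1,l_1)\,(h_2l_2\cdot r)\,\sigma^{-1}(h_3,l_3),$$ such that the crossed product $R\#_\sigma H$, which is the vector space $R\otimes H$ with the multiplication $(a\# h)(b\# l)=\sum a(h_1\cdot b)\sigma(h_2,l_1)\# h_3l_2$, is an associative algebra with unit $1\#1$. Let $r_j$ denote the Jacobson radical. An $R$-$H$-module is an $R$-module $M$ with a $k$-linear map $H\otimes M\to M$ such that $1m=m$, $h(am)=\sum(h_1\cdot a)(h_2m)$ and $h(lm)=\sum\sigma(h_1,l_1)((h_2l_2)m)$; it is irreducible if $RM\neq0$ and its only $R$-$H$-submodules are $0$ and $M$. Let $r_{Hj}(R)$ be the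 intersection of the annihilators in $R$ of all irreducible $R$-$H$-modules, and $r_{jH}(R)=(r_j(R):H)=\{x\in R\mid h\cdot x\in r_j(R)\text{ for all }h\in H\}$. Then: (1) $r_j(R)=r_{Hj}(R)=r_{jH}(R)$. In particular $h\cdot r_j(R)\subseteq r_j(R)$ for all $h\in H$. For $H=(kG)^*$, with $(p_g)_{g\in G}$ the basis dual to $G$, this says that the Jacobson radical of the twisted $G$-graded algebra $R$ is graded: for $x\in r_j(R)$ all the components $p_g\cdot x$ lie in $r_j(R)$, and $x=\sum_{g\in G}p_g\cdot x$. (2) $r_j(R\#_\sigma H)=r_{Hj}(R)\#_\sigma H$, the subspace spanned by all $a\# h$ with $a\in r_{Hj}(R)$, $h\in H$. -/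

import Mathlib

noncomputable section

set_option linter.unusedSectionVars false

namespace TwistedHopf

open TensorProduct Coalgebra WithConv

universe u v w

/-! ### Crossed products -/

section CrossedMul

variable {k : Type u} [Field k] {H : Type v} [Ring H] [HopfAlgebra k H]
  {R : Type w} [Ring R] [Algebra k R]

/-- The linear map `h ⊗ l ↦ ∑ σ(h₁, l₁) ⊗ h₂ l₂`. -/
def cocyclePart (σ : H ⊗[k] H →ₗ[k] R) : H ⊗[k] H →ₗ[k] R ⊗[k] H :=
  TensorProduct.map σ (LinearMap.mul' k H) ∘ₗ comul

/-- The map `(h, b, l) ↦ ∑ (h₁ · b) σ(h₂, l₁) ⊗ h₃ l₂`, i.e. the product `(1 # h)(b # l)`. -/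
def twistPart (act : H →ₗ[k] R →ₗ[k] R) (σ : H ⊗[k] H →ₗ[k] R) :
    H →ₗ[k] R →ₗ[k] H →ₗ[k] R ⊗[k] H :=
  TensorProduct.lift
    (LinearMap.mk₂ k
      (fun x y => (Algebra.lsmul k k (R ⊗[k] H)).toLinearMap.compl₁₂ (act x)
        (TensorProduct.curry (cocyclePart σ) y))
      (fun x x' y => by ext; simp)
      (fun c x y => by ext; simp)
      (fun x y y' => by ext; simp)
      (fun c x y => by ext; simp)) ∘ₗ comul

/-- The multiplication of the crossed product on the vector space `R ⊗ H`:
`(a # h)(b # l) = ∑ a (h₁ · b) σ(h₂, l₁) # h₃ l₂`. -/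
def crossedMul (act : H →ₗ[k] R →ₗ[k] R) (σ : H ⊗[k] H →ₗ[k] R) :
    R ⊗[k] H →ₗ[k] R ⊗[k] H →ₗ[k] R ⊗[k] H :=
  TensorProduct.lift
    (LinearMap.mk₂ k
      (fun a h => Algebra.lsmul k k (R ⊗[k] H) a ∘ₗ TensorProduct.lift (twistPart act σ h))
      (fun a a' h => by ext; simp)
      (fun c a h => by ext; simp)
      (fun a h h' => by ext; simp)
      (fun c a h => by ext; simp [smul_comm a c]))

/-- The formula defining the crossed product, with explicit representatives
`Δ h = ∑ hᵢ' ⊗ hᵢ''` and `Δ (hᵢ'' ⊗ l) = ∑ xⱼ ⊗ yⱼ` (the coproduct of `H ⊗ H`). -/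
theorem crossedMul_tmul (act : H →ₗ[k] R →ₗ[k] R) (σ : H ⊗[k] H →ₗ[k] R) (a b : R) (h l : H) :
    crossedMul act σ (a ⊗ₜ h) (b ⊗ₜ l) =
      ∑ i ∈ (ℛ k h).index, ∑ j ∈ (ℛ k ((ℛ k h).right i ⊗ₜ[k] l)).index,
        (a * act ((ℛ k h).left i) b * σ ((ℛ k ((ℛ k h).right i ⊗ₜ[k] l)).left j)) ⊗ₜ[k]
          LinearMap.mul' k H ((ℛ k ((ℛ k h).right i ⊗ₜ[k] l)).right j) := by
  have h1 : crossedMul act σ (a ⊗ₜ h) (b ⊗ₜ l) = a • twistPart act σ h b l := by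
    simp [crossedMul]
  rw [h1, twistPart, LinearMap.comp_apply, ← (ℛ k h).eq]
  simp only [map_sum, LinearMap.sum_apply, Finset.smul_sum]
  refine Finset.sum_congr rfl fun i _ => ?_
  simp only [TensorProduct.lift.tmul, LinearMap.mk₂_apply, LinearMap.compl₁₂_apply,
    TensorProduct.curry_apply, cocyclePart, LinearMap.comp_apply]
  rw [← (ℛ k ((ℛ k h).right i ⊗ₜ[k] l)).eq]
  simp [Finset.smul_sum, TensorProduct.smul_tmul', mul_assoc]

end CrossedMul

/-- A twisted `H`-module algebra structure on the unital `k`-algebra `R`, such that the crossed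
product `R #_σ H` is an associative algebra with unit `1 # 1`: a weak action of `H` on `R` together
with a convolution-invertible map `σ : H ⊗ H → R`. Products in `WithConv` are convolution
products, computed for functions on `H ⊗ H` with its tensor product coalgebra structure.
The axioms imply `h · 1 = ε(h) 1`, `σ(h, 1) = σ(1, h) = ε(h) 1` and the cocycle condition. -/
structure TwistedModuleAlgebra (k : Type u) [Field k] (H : Type v) [Ring H] [HopfAlgebra k H]
    (R : Type w) [Ring R] [Algebra k R] where
  /-- the weak action `h ⊗ r ↦ h · r` -/
  act : H →ₗ[k] R →ₗ[k] R
  /-- `1 · r = r` -/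
  one_act : ∀ r, act 1 r = r
  /-- `h · (r s) = ∑ (h₁ · r) (h₂ · s)` -/
  act_mul : ∀ (r s : R) (h : H),
    act h (r * s) = (toConv (act.flip r) * toConv (act.flip s)) h
  /-- the map `σ` -/
  σ : H ⊗[k] H →ₗ[k] R
  /-- the convolution inverse `σ⁻¹` of `σ` -/
  σinv : H ⊗[k] H →ₗ[k] R
  σ_mul_σinv : toConv σ * toConv σinv = 1
  σinv_mul_σ : toConv σinv * toConv σ = 1
  /-- `h · (l · r) = ∑ σ(h₁, l₁) (h₂ l₂ · r) σ⁻¹(h₃, l₃)` -/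
  act_act : ∀ (h l : H) (r : R), act h (act l r) =
    (toConv σ * toConv (act.flip r ∘ₗ LinearMap.mul' k H) * toConv σinv) (h ⊗ₜ[k] l)
  /-- the crossed product is associative with unit `1 # 1` -/
  crossed_assoc : ∀ x y z : R ⊗[k] H,
    crossedMul act σ (crossedMul act σ x y) z = crossedMul act σ x (crossedMul act σ y z)
  one_crossed : ∀ x : R ⊗[k] H, crossedMul act σ (1 ⊗ₜ 1) x = x
  crossed_one : ∀ x : R ⊗[k] H, crossedMul act σ x (1 ⊗ₜ 1) = x

/-- The Jacobson radical `r_j(A)` of a `k`-algebra `A`, as a subspace. -/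
def jac (k : Type u) [Field k] (A : Type v) [Ring A] [Algebra k A] : Submodule k A :=
  (Ring.jacobson A : Ideal A).restrictScalars k

namespace TwistedModuleAlgebra

variable {k : Type u} [Field k] {H : Type v} [Ring H] [HopfAlgebra k H]
  {R : Type w} [Ring R] [Algebra k R]

/-- The underlying vector space `R ⊗ H` of the crossed product `R #_σ H`. -/
def CrossedProduct (_D : TwistedModuleAlgebra k H R) : Type (max v w) := R ⊗[k] H

instance (D : TwistedModuleAlgebra k H R) : AddCommGroup D.CrossedProduct :=
  inferInstanceAs (AddCommGroup (R ⊗[k] H))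

instance (D : TwistedModuleAlgebra k H R) : Module k D.CrossedProduct :=
  inferInstanceAs (Module k (R ⊗[k] H))

/-- The crossed product `R #_σ H` as a ring. -/
instance (D : TwistedModuleAlgebra k H R) : Ring D.CrossedProduct :=
  { (inferInstance : AddCommGroup D.CrossedProduct) with
    mul := fun x y => crossedMul D.act D.σ x y
    one := (1 ⊗ₜ[k] 1 : R ⊗[k] H)
    left_distrib := fun x y z => (crossedMul D.act D.σ x).map_add y z
    right_distrib := fun x y z => (crossedMul D.act D.σ).map_add₂ x y z
    zero_mul := fun x => (crossedMul D.act D.σ).map_zero₂ x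
    mul_zero := fun x => (crossedMul D.act D.σ x).map_zero
    mul_assoc := D.crossed_assoc
    one_mul := D.one_crossed
    mul_one := D.crossed_one }

instance (D : TwistedModuleAlgebra k H R) : Algebra k D.CrossedProduct :=
  Algebra.ofModule (fun c x y => (crossedMul D.act D.σ).map_smul₂ c x y)
    (fun c x y => (crossedMul D.act D.σ x).map_smul c y)

/-- For a subspace `I` of `R`, the subspace `I #_σ H` of `R #_σ H`
spanned by the elements `a # h` with `a ∈ I` and `h ∈ H`. -/
def crossedSubspace (D : TwistedModuleAlgebra k H R) (I : Submodule k R) :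
    Submodule k D.CrossedProduct :=
  Submodule.span k {x | ∃ a ∈ I, ∃ h : H, x = (a ⊗ₜ[k] h : R ⊗[k] H)}

/-! ### Radicals -/

/-- `(I : H) = {x ∈ R | h · x ∈ I for all h ∈ H}`. -/
def colon (D : TwistedModuleAlgebra k H R) (I : Submodule k R) : Submodule k R where
  carrier := {x | ∀ h : H, D.act h x ∈ I}
  add_mem' := fun hx hy h => by
    rw [map_add]
    exact I.add_mem (hx h) (hy h)
  zero_mem' := fun h => by simp
  smul_mem' := fun c x hx h => by
    rw [map_smul]
    exact I.smul_mem c (hx h)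

/-- A (twisted) `R`-`H`-module structure on the `R`-module `M`: an action of `H` on `M` with
`1 m = m`, `h (a m) = ∑ (h₁ · a) (h₂ m)` and `h (l m) = ∑ σ(h₁, l₁) ((h₂ l₂) m)`.
If `σ` is trivial, the last condition says that `M` is an `H`-module. -/
structure RHModule (D : TwistedModuleAlgebra k H R) (M : Type*) [AddCommGroup M] [Module k M]
    [Module R M] [IsScalarTower k R M] where
  /-- the action `h ⊗ m ↦ h m` -/
  act : H →ₗ[k] M →ₗ[k] M
  one_act : ∀ m, act 1 m = m
  act_smul : ∀ (h : H) (a : R) (m : M), act h (a • m) =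
    TensorProduct.lift ((Algebra.lsmul k k M).toLinearMap.compl₁₂ (D.act.flip a) (act.flip m))
      (comul h)
  act_act : ∀ (h l : H) (m : M), act h (act l m) =
    TensorProduct.lift ((Algebra.lsmul k k M).toLinearMap.compl₁₂ D.σ
      (act.flip m ∘ₗ LinearMap.mul' k H)) (comul (h ⊗ₜ[k] l))

/-- An `R`-`H`-module is irreducible if it is nonzero (for unitary modules, `M ≠ 0` is the same as
`R M ≠ 0`) and has no `R`-`H`-submodules except `0` and itself. -/
def RHModule.IsIrreducible {D : TwistedModuleAlgebra k H R} {M : Type*} [AddCommGroup M]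
    [Module k M] [Module R M] [IsScalarTower k R M] (A : RHModule D M) : Prop :=
  Nontrivial M ∧ ∀ N : Submodule R M, (∀ (h : H), ∀ m ∈ N, A.act h m ∈ N) → N = ⊥ ∨ N = ⊤

/-- The `H`-Jacobson radical `r_{Hj}(R)`: the intersection of the annihilators in `R` of all
irreducible `R`-`H`-modules. (Up to isomorphism these are all quotients of `R ⊗ H`, so the
universe of `R ⊗ H` is large enough.) -/
def hJacobson (D : TwistedModuleAlgebra k H R) : Submodule k R :=
  (sInf {I : Ideal R | ∃ (M : Type (max v w)) (_ : AddCommGroup M) (_ : Module k M)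
    (_ : Module R M) (_ : IsScalarTower k R M) (A : RHModule D M),
      A.IsIrreducible ∧ I = Module.annihilator R M}).restrictScalars k

/-- `r_{jH}(R) = (r_j(R) : H)`. -/
def jacobsonH (D : TwistedModuleAlgebra k H R) : Submodule k R := D.colon (jac k R)

end TwistedModuleAlgebra

/-! ### The dual Hopf algebra `(kG)^*` -/

/-- The dual `(kG)^*` of the group algebra of a finite group, a linear functional on `kG` being
identified with the function on `G` given by its values on the basis `G`. -/
def GroupDual (k : Type u) (G : Type v) : Type (max u v) := G → k

namespace GroupDual

section Basic

variable {k : Type u} [Field k] {G : Type v}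

/-- The multiplication dual to `Δ g = g ⊗ g` is the pointwise one. -/
instance : CommRing (GroupDual k G) := inferInstanceAs (CommRing (G → k))

instance : Algebra k (GroupDual k G) := inferInstanceAs (Algebra k (G → k))

/-- The dual basis `p_g` of the basis `G` of `kG`. -/
def p (k : Type u) [Field k] {G : Type v} [DecidableEq G] (g : G) : GroupDual k G :=
  (Pi.single g 1 : G → k)

/-- Evaluation of a functional at a group element. -/
def eval (k : Type u) [Field k] {G : Type v} (g : G) : GroupDual k G →ₗ[k] k :=
  (LinearMap.proj g : (G → k) →ₗ[k] k)

theorem ext_eval {f f' : GroupDual k G} (h : ∀ g, eval k g f = eval k g f') : f = f' :=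
  funext h

theorem eval_mul (g : G) (f f' : GroupDual k G) : eval k g (f * f') = eval k g f * eval k g f' :=
  rfl

theorem eval_one (g : G) : eval k g (1 : GroupDual k G) = 1 := rfl

@[simp] theorem eval_p [DecidableEq G] (g h : G) :
    eval k g (p k h) = if g = h then 1 else 0 :=
  Pi.single_apply h (1 : k) g

end Basic

section Hopf

variable {k : Type u} [Field k] {G : Type v} [Group G] [Fintype G] [DecidableEq G]

theorem sum_p : ∑ g, p k g = (1 : GroupDual k G) := by
  refine ext_eval fun x => ?_
  simp [map_sum, eval_one]

theorem sum_eval_smul_p (f : GroupDual k G) : ∑ g, eval k g f • p k g = f := by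
  refine ext_eval fun g => ?_
  simp [map_sum]

theorem p_mul_p (g h : G) : p k g * p k h = if g = h then p k g else 0 := by
  refine ext_eval fun x => ?_
  rw [eval_mul]
  split_ifs with hgh
  · subst hgh; simp
  · simp only [eval_p, map_zero]
    grind

theorem hom_ext {M : Type*} [AddCommMonoid M] [Module k M] {f f' : GroupDual k G →ₗ[k] M}
    (h : ∀ g, f (p k g) = f' (p k g)) : f = f' := by
  ext x
  rw [← sum_eval_smul_p x]
  simp [map_sum, h]

/-- The coproduct `Δ f = ∑_{x, y} f(x y) p_x ⊗ p_y`, dual to the multiplication of `kG`. -/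
def comulMap (k : Type u) [Field k] (G : Type v) [Group G] [Fintype G] [DecidableEq G] :
    GroupDual k G →ₗ[k] GroupDual k G ⊗[k] GroupDual k G :=
  ∑ x, ∑ y, (eval k (x * y)).smulRight (p k x ⊗ₜ[k] p k y)

/-- `Δ f`, viewed as a function on `G × G`, is `(x, y) ↦ f(x y)`. -/
theorem eval_comulMap (f : GroupDual k G) (x y : G) :
    TensorProduct.lid k k (TensorProduct.map (eval k x) (eval k y) (comulMap k G f)) =
      eval k (x * y) f := by
  simp [comulMap, LinearMap.sum_apply]

theorem comulMap_p (g : G) : comulMap k G (p k g) = ∑ x, p k x ⊗ₜ[k] p k (x⁻¹ * g) := by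
  simp only [comulMap, LinearMap.sum_apply, LinearMap.smulRight_apply, eval_p, ite_smul, one_smul,
    zero_smul]
  refine Finset.sum_congr rfl fun x _ => ?_
  simp [← eq_inv_mul_iff_mul_eq]

/-- The Hopf algebra `(kG)^*`: multiplication, unit, comultiplication, counit `f ↦ f(1)` and
antipode `(S f)(g) = f(g⁻¹)` are dual to those of `kG`. -/
instance : Coalgebra k (GroupDual k G) where
  comul := comulMap k G
  counit := eval k 1
  coassoc := by
    refine hom_ext fun g => ?_
    simp only [LinearMap.comp_apply, comulMap_p, map_sum, LinearMap.rTensor_tmul,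
      LinearMap.lTensor_tmul, TensorProduct.sum_tmul, TensorProduct.tmul_sum,
      LinearEquiv.coe_coe, TensorProduct.assoc_tmul]
    rw [Finset.sum_comm]
    refine Finset.sum_congr rfl fun x _ => ?_
    refine Fintype.sum_equiv (Equiv.mulLeft x⁻¹) _ _ fun y => ?_
    simp [mul_assoc]
  rTensor_counit_comp_comul := by
    refine hom_ext fun g => ?_
    simp [comulMap_p, TensorProduct.ite_tmul]
  lTensor_counit_comp_comul := by
    refine hom_ext fun g => ?_
    simp [comulMap_p, TensorProduct.tmul_ite, eq_inv_mul_iff_mul_eq]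

theorem comul_p (g : G) :
    comul (R := k) (p k g) = ∑ x, p k x ⊗ₜ[k] p k (x⁻¹ * g) := comulMap_p g

theorem counit_eq (f : GroupDual k G) : counit (R := k) f = eval k 1 f := rfl

instance : Bialgebra k (GroupDual k G) :=
  Bialgebra.mk' k (GroupDual k G) rfl (fun {_ _} => rfl)
    (by
      have h1 : (1 : GroupDual k G) = ∑ g, p k g := by
        rw [← sum_eval_smul_p (1 : GroupDual k G)]
        simp [eval_one]
      rw [Algebra.TensorProduct.one_def, h1]
      simp only [map_sum, comul_p, TensorProduct.sum_tmul, TensorProduct.tmul_sum]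
      rw [Finset.sum_comm]
      conv_rhs => rw [Finset.sum_comm]
      refine Finset.sum_congr rfl fun x _ => ?_
      exact Fintype.sum_equiv (Equiv.mulLeft x⁻¹) _ _ fun y => rfl)
    (by
      intro a b
      have h : (LinearMap.mul k (GroupDual k G)).compr₂ comul =
          (LinearMap.mul k (GroupDual k G ⊗[k] GroupDual k G)).compl₁₂ comul comul := by
        refine hom_ext fun g => hom_ext fun h => ?_
        simp only [LinearMap.compr₂_apply, LinearMap.mul_apply', LinearMap.compl₁₂_apply, p_mul_p,
          comul_p, Finset.sum_mul_sum, Algebra.TensorProduct.tmul_mul_tmul, TensorProduct.ite_tmul]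
        by_cases hgh : g = h
        · subst hgh
          simp [comul_p]
        · simp [hgh]
      exact congr($h a b))

/-- The antipode `(S f)(g) = f(g⁻¹)`. -/
def antipodeMap (k : Type u) [Field k] (G : Type v) [Group G] :
    GroupDual k G →ₗ[k] GroupDual k G :=
  (LinearMap.funLeft k k (fun g : G => g⁻¹) : (G → k) →ₗ[k] (G → k))

theorem eval_antipodeMap (f : GroupDual k G) (g : G) :
    eval k g (antipodeMap k G f) = eval k g⁻¹ f := rfl

theorem antipodeMap_p (g : G) : antipodeMap k G (p k g) = p k g⁻¹ := by
  refine ext_eval fun x => ?_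
  simp [eval_antipodeMap, inv_eq_iff_eq_inv]

instance : HopfAlgebra k (GroupDual k G) where
  antipode := antipodeMap k G
  mul_antipode_rTensor_comul := by
    refine hom_ext fun g => ?_
    simp only [LinearMap.comp_apply, comul_p, map_sum, LinearMap.rTensor_tmul, antipodeMap_p,
      LinearMap.mul'_apply, p_mul_p, counit_eq, eval_p, Algebra.linearMap_apply]
    by_cases hg : g = 1
    · subst hg
      simp only [mul_one, if_true, map_one]
      rw [← sum_p]
      exact Fintype.sum_equiv (Equiv.inv G) _ _ fun y => rfl
    · simp [hg, Ne.symm hg]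
  mul_antipode_lTensor_comul := by
    refine hom_ext fun g => ?_
    simp only [LinearMap.comp_apply, comul_p, map_sum, LinearMap.lTensor_tmul, antipodeMap_p,
      LinearMap.mul'_apply, p_mul_p, counit_eq, eval_p, Algebra.linearMap_apply, mul_inv_rev,
      inv_inv]
    by_cases hg : g = 1
    · subst hg
      simp [sum_p]
    · simp [hg, Ne.symm hg]

end Hopf

end GroupDual

end TwistedHopf

end

/-!
Write `A = R #_σ H`. Both cases reduce to two facts about `J(R)`: it is stable under the action of
`H`, and `J(A) ⊆ J(R) # H`. Given these (`radicals_eq`), everything else is formal. A simple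
`A`-module is an irreducible `R`-`H`-module, so `r_{Hj}(R) ⊆ J(A) ∩ R` (`hJacobson_le`). The map
`id ⊗ ε : A → R` is a left `R`-linear retraction, so `J(A) ∩ R ⊆ J(R)` (`comap_jacobson_le`). As `H`
is finite dimensional, an irreducible `R`-`H`-module `M` is finitely generated over `R`, and
`J(R) M` is an `R`-`H`-submodule because `J(R)` is stable; it is not `M` by Nakayama's lemma, hence
it vanishes and `J(R) ⊆ r_{Hj}(R)` (`jac_le_hJacobson`).

For `H = kG` the elements `1 # g` are units of `A` that normalize `R`. So `g` acts on `R` by a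
surjective ring endomorphism, which preserves `J(R)`. For a maximal left ideal `m` of `R` the
`A`-module `A / A m` is semisimple over `R`, being spanned by the classes of the `1 # g`, each of
which generates a simple `R`-module or vanishes; averaging over `G` as in Maschke's theorem shows
`J(A) ⊆ A m` (`jacobson_le_of_normalizing`), and one reads off coefficients.

For `H = (kG)^*` the group `G` acts on `A` by the automorphisms `a # f ↦ a # f(· s)`, with fixed
ring `R`. The convolution inverse of `σ` yields elements `c_x` with
`∑_x c_x s(1 # p_{x⁻¹}) = δ_{s,1}`, i.e. `A` is Galois over `R` (`sum_galoisElt_mul_dualElt`). Hence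
`y = ∑_x tr(y c_x) (1 # p_{x⁻¹})` for all `y ∈ A`, and as `J(A)` is stable under `G`, this gives
`J(A) ⊆ (J(A) ∩ R) # H ⊆ J(R) # H`. Finally `J(R) ⊆ J(A)` when `|G|` is invertible
(`jacobson_le_comap_of_fixed`, again by averaging), so for `x ∈ J(R)` the product
`(1 # p_g)(x # 1) = ∑_y (p_y · x) # p_{y⁻¹ g}` lies in `J(A)`, and its coefficients `p_y · x` lie in
`J(R)`.
-/

noncomputable section

namespace TwistedHopf

open TensorProduct Coalgebra WithConv

universe u v w

/-! ### The Jacobson radical and finite group actions -/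

section Radical

/-- A projection of `M / K` onto the image of `N`, composed with `M → M / K`. -/
theorem exists_linearMap_quotient_eq_mkQ {S M : Type*} [Ring S] [AddCommGroup M] [Module S M]
    (K N : Submodule S M) [IsSemisimpleModule S (M ⧸ K)] :
    ∃ q : M →ₗ[S] M ⧸ K, (∀ m, ∃ n ∈ N, q m = K.mkQ n) ∧ ∀ n ∈ N, q n = K.mkQ n := by
  obtain ⟨C, hC⟩ := exists_isCompl (N.map K.mkQ)
  refine ⟨(N.map K.mkQ).subtype ∘ₗ Submodule.projectionOnto _ C hC ∘ₗ K.mkQ, fun m => ?_,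
    fun n hn => ?_⟩
  · obtain ⟨n, hn, h⟩ := (Submodule.projectionOnto _ C hC (K.mkQ m)).2
    exact ⟨n, hn, h.symm⟩
  · exact congrArg Subtype.val (Submodule.projectionOnto_apply_left hC
      ⟨K.mkQ n, Submodule.mem_map_of_mem hn⟩)

theorem exists_mul_one_sub_eq_one {R : Type*} [Ring R] {x : R} (hx : x ∈ Ring.jacobson R) :
    ∃ z, z * (1 - x) = 1 := by
  rw [← Ideal.jacobson_bot, Ideal.mem_jacobson_iff] at hx
  obtain ⟨z, hz⟩ := hx (-1)
  refine ⟨z, ?_⟩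
  rw [Ideal.mem_bot, sub_eq_zero] at hz
  have h1 : z * (1 - x) = z * -1 * x + z := by
    rw [mul_sub, mul_one, mul_neg_one, neg_mul, neg_add_eq_sub]
  rw [h1, hz]

theorem exists_one_sub_mul_eq_one {R : Type*} [Ring R] {x : R} (hx : x ∈ Ring.jacobson R) :
    ∃ z, (1 - x) * z = 1 := by
  obtain ⟨v, hv⟩ := exists_mul_one_sub_eq_one hx
  obtain ⟨u, hu⟩ := exists_mul_one_sub_eq_one (neg_mem (Ideal.mul_mem_left _ v hx))
  have h1 : v = 1 - -(v * x) := by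
    rw [sub_neg_eq_add, ← sub_eq_iff_eq_add, ← hv]
    noncomm_ring
  rw [← h1] at hu
  refine ⟨v, ?_⟩
  rwa [← left_inv_eq_right_inv hu hv]

/-- Let `j = ι x ∈ L` with `x ∈ J(S)`, and let right multiplication by `j` be the identity on `L`
modulo the left ideal `I`. Then `L ⊆ I`: as `(1 - j) j ∈ I` and `1 - j` is invertible, `j ∈ I`, so
`n ≡ n j ≡ 0` for all `n ∈ L`. -/
theorem mem_of_sub_mul_mem {S A : Type*} [Ring A] (I : Ideal A) (L : Set A) [Ring S] (ι : S →+* A)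
    {x : S} (hx : x ∈ Ring.jacobson S) (hxL : ι x ∈ L) (h : ∀ n ∈ L, n - n * ι x ∈ I) {n : A}
    (hn : n ∈ L) : n ∈ I := by
  obtain ⟨z, hz⟩ := exists_mul_one_sub_eq_one hx
  have h1 : ι x ∈ I := by
    have h2 := I.mul_mem_left (ι z) (h _ hxL)
    have h3 : ι z * (ι x - ι x * ι x) = ι x := by
      rw [← map_mul, ← map_sub, ← map_mul, ← one_sub_mul, ← mul_assoc, hz, one_mul]
    rwa [h3] at h2
  simpa using I.add_mem (h n hn) (I.mul_mem_left n h1)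

/-- If `R` is a direct summand of `A` as a left `R`-module, then `J(A) ∩ R ⊆ J(R)`: inverses in `A`
of elements of `1 + J(A) ∩ R` project to right inverses in `R`. -/
theorem comap_jacobson_le_of_retraction {R A : Type*} [Ring R] [Ring A] (ι : R →+* A)
    (π : A →+ R) (hπ : ∀ r a, π (ι r * a) = r * π a) (h1 : π 1 = 1) :
    (Ring.jacobson A).comap ι ≤ Ring.jacobson R := by
  have key : ∀ x : R, ι x ∈ Ring.jacobson A → ∃ w, (1 - x) * w = 1 := by
    intro x hx
    obtain ⟨v, hv⟩ := exists_one_sub_mul_eq_one hx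
    refine ⟨π v, ?_⟩
    rw [← hπ, map_sub, map_one, hv, h1]
  -- The right inverse `w` of `1 - x` is itself in `1 + J(A) ∩ R`, so it is a unit.
  have key' : ∀ x : R, ι x ∈ Ring.jacobson A → ∃ w, w * (1 - x) = 1 := by
    intro x hx
    obtain ⟨w, hw⟩ := key x hx
    have h2 : w = 1 - -(x * w) := by
      rw [sub_neg_eq_add, ← sub_eq_iff_eq_add, ← hw]
      noncomm_ring
    obtain ⟨u, hu⟩ := key (-(x * w)) (by
      rw [map_neg, map_mul]
      exact neg_mem (Ideal.mul_mem_right _ _ hx))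
    rw [← h2] at hu
    refine ⟨w, ?_⟩
    rwa [left_inv_eq_right_inv hw hu]
  intro x hx
  rw [Ring.jacobson_eq_sInf_isMaximal, Submodule.mem_sInf]
  intro m (hm : Ideal.IsMaximal m)
  by_contra hxm
  obtain ⟨t, n, hn, htn⟩ := hm.exists_inv hxm
  obtain ⟨w, hw⟩ := key' (t * x) (by
    rw [map_mul]
    exact Ideal.mul_mem_left _ _ hx)
  refine hm.ne_top ((Ideal.eq_top_iff_one _).2 ?_)
  rw [← hw, ← htn, add_sub_cancel_left]
  exact Ideal.mul_mem_left _ _ hn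

theorem isSemisimpleModule_quotient_iInf {A G : Type*} [Ring A] [Finite G] (m : G → Ideal A)
    [∀ g, (m g).IsMaximal] : IsSemisimpleModule A (A ⧸ (⨅ g, m g)) := by
  have : ∀ g, IsSimpleModule A (A ⧸ m g) := fun g =>
    isSimpleModule_iff_isCoatom.2 (Ideal.isMaximal_def.1 inferInstance)
  let f : A →ₗ[A] (∀ g, A ⧸ m g) := LinearMap.pi fun g => (m g).mkQ
  have hf : f.ker = ⨅ g, m g := by
    simp [f, LinearMap.ker_pi]
  rw [← hf]
  refine IsSemisimpleModule.of_injective (f.ker.liftQ f le_rfl) ?_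
  rw [← LinearMap.ker_eq_bot]
  exact Submodule.ker_liftQ_eq_bot _ _ _ le_rfl

/-- If a finite group `G` of order invertible in `k` acts on `A`, fixing `R` and with all traces in
`R`, then `J(R) ⊆ J(A)`. For a maximal left ideal `m` of `A` let `I` be the intersection of its
`G`-translates, so that `A / I` is semisimple, and put `L = A J(R)`. A projection of `A / I` onto the
image of `L` sends `1` to the class of some `y ∈ L`, so `n ≡ n y` for `n ∈ L`. As `L` and `I` are
stable under `G`, `y` may be replaced by its average over `G`, which lies in `J(R)`; therefore
`L ⊆ I`. -/
theorem jacobson_le_comap_of_fixed {k R A G : Type*} [Field k] [Ring R] [Algebra k R] [Ring A]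
    [Algebra k A] [Group G] [Fintype G] [MulSemiringAction G A]
    (hG : (Fintype.card G : k) ≠ 0) (ι : R →ₐ[k] A) (hι : ∀ (g : G) r, g • ι r = ι r)
    (htr : ∀ a : A, ∃ r, ∑ g : G, g • a = ι r) :
    Ring.jacobson R ≤ (Ring.jacobson A).comap ι := by
  intro x hx
  rw [Ideal.mem_comap, Ring.jacobson_eq_sInf_isMaximal, Submodule.mem_sInf]
  intro m (hm : Ideal.IsMaximal m)
  let m' : G → Ideal A := fun g => Ideal.comap (MulSemiringAction.toRingEquiv G A g) m
  have hm' : ∀ g, (m' g).IsMaximal := fun g => Ideal.comap_isMaximal_of_equiv _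
  have := isSemisimpleModule_quotient_iInf m'
  set I : Ideal A := ⨅ g, m' g with hI
  have hmemI : ∀ a, a ∈ I ↔ ∀ g : G, g • a ∈ m := fun a => Submodule.mem_iInf _
  have hIG : ∀ a ∈ I, ∀ g : G, g • a ∈ I := by
    intro a ha g
    rw [hmemI] at ha ⊢
    intro g'
    rw [smul_smul]
    exact ha _
  let L : Ideal A := Ideal.span (ι '' Ring.jacobson R)
  have hLG : ∀ a ∈ L, ∀ g : G, g • a ∈ L := by
    intro a ha g
    have : L ≤ Ideal.comap (MulSemiringAction.toRingEquiv G A g) L := by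
      refine Ideal.span_le.2 ?_
      rintro _ ⟨r, hr, rfl⟩
      refine Ideal.mem_comap.2 ?_
      simpa [hι] using Ideal.subset_span (Set.mem_image_of_mem ι hr)
    simpa using this ha
  -- The factor `b` makes the statement stable under left multiplication in the span induction.
  have hLtr : ∀ y ∈ L, ∀ b : A, ∃ r ∈ Ring.jacobson R, ∑ g : G, g • (b * y) = ι r := by
    intro y hy
    refine Submodule.span_induction ?_ ?_ ?_ ?_ hy
    · rintro _ ⟨r, hr, rfl⟩ b
      obtain ⟨t, ht⟩ := htr b
      refine ⟨t * r, Ideal.mul_mem_left _ _ hr, ?_⟩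
      simp [smul_mul', hι, ← Finset.sum_mul, ht]
    · intro b
      exact ⟨0, zero_mem _, by simp⟩
    · intro y z _ _ hy hz b
      obtain ⟨r, hr, h1⟩ := hy b
      obtain ⟨s, hs, h2⟩ := hz b
      refine ⟨r + s, add_mem hr hs, ?_⟩
      rw [map_add, ← h1, ← h2, ← Finset.sum_add_distrib]
      simp only [mul_add, smul_add]
    · intro a y _ hy b
      simpa [mul_assoc] using hy (b * a)
  obtain ⟨q, hq, hqL⟩ := exists_linearMap_quotient_eq_mkQ I L
  obtain ⟨y, hyL, hy⟩ := hq 1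
  have hny : ∀ n ∈ L, n - n * y ∈ I := by
    intro n hn
    have h1 := hqL n hn
    have h2 : q n = n • q 1 := by rw [← map_smul, smul_eq_mul, mul_one]
    rw [h2, hy, ← map_smul, eq_comm] at h1
    exact (Submodule.Quotient.eq I).1 h1
  obtain ⟨r, hr, hyr⟩ := hLtr y hyL 1
  rw [one_mul] at hyr
  have hsub : ∀ n ∈ L, n - n * ι ((Fintype.card G : k)⁻¹ • r) ∈ I := by
    intro n hn
    have h1 : ∀ g : G, n - n * (g • y) ∈ I := by
      intro g
      have h2 := hIG _ (hny _ (hLG n hn g⁻¹)) g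
      rwa [smul_sub, smul_mul', smul_inv_smul] at h2
    have h2 := Submodule.smul_of_tower_mem I (Fintype.card G : k)⁻¹
      (sum_mem fun g (_ : g ∈ Finset.univ) => h1 g)
    have h3 : (Fintype.card G : k)⁻¹ • ∑ g : G, (n - n * (g • y)) =
        n - n * ι ((Fintype.card G : k)⁻¹ • r) := by
      rw [Finset.sum_sub_distrib, ← Finset.mul_sum, hyr, smul_sub, map_smul, mul_smul_comm]
      rw [Finset.sum_const, Finset.card_univ, ← Nat.cast_smul_eq_nsmul k, smul_smul,
        inv_mul_cancel₀ hG, one_smul]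
    rwa [h3] at h2
  have hr' : (Fintype.card G : k)⁻¹ • r ∈ Ring.jacobson R := Submodule.smul_of_tower_mem _ _ hr
  have hxI := mem_of_sub_mul_mem I (L : Set A) ι.toRingHom hr'
    (Ideal.subset_span (Set.mem_image_of_mem ι hr')) hsub
    (Ideal.subset_span (Set.mem_image_of_mem ι hx))
  simpa using (hmemI _).1 hxI 1

end Radical

/-! ### Maschke's theorem for extensions generated by normalizing units -/

section Maschke

variable {k R A G : Type*} [Field k] [Ring R] [Ring A] [Algebra k A] [Module R A]
  [IsScalarTower R A A] {u : G → Aˣ}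

/-- If `A` is spanned over `R` by units `u g` normalizing `R` and the left ideal `I` of `A` contains a
maximal left ideal `m` of `R`, then `A / I` is semisimple over `R`: the class of each `u g` is
annihilated by a conjugate of `m`, hence it vanishes or spans a simple `R`-module. -/
theorem isSemisimpleModule_quotient_of_normalizing
    (hl : ∀ g (r : R), ∃ s : R, r • (u g : A) = u g * (s • (1 : A)))
    (hr : ∀ g (s : R), ∃ r : R, (u g : A) * (s • (1 : A)) = r • (u g : A))
    (hspan : Submodule.span R (Set.range fun g => (u g : A)) = ⊤)
    (m : Ideal R) [m.IsMaximal] (I : Ideal A) (hI : ∀ x ∈ m, x • (1 : A) ∈ I) :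
    IsSemisimpleModule R (A ⧸ I.restrictScalars R) := by
  let v : G → A ⧸ I.restrictScalars R := fun g => (I.restrictScalars R).mkQ (u g)
  refine isSemisimpleModule_of_isSemisimpleModule_submodule' (p := fun g => Submodule.span R {v g})
    (fun g => ?_) ?_
  · by_cases hv : v g = 0
    · rw [hv, Submodule.span_zero_singleton]
      have : Subsingleton (Submodule R (⊥ : Submodule R (A ⧸ I.restrictScalars R))) := inferInstance
      exact { exists_isCompl := fun N => ⟨N, disjoint_iff.2 (Subsingleton.elim _ _),
        codisjoint_iff.2 (Subsingleton.elim _ _)⟩ }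
    · have : IsSimpleModule R (Submodule.span R {v g}) := by
        rw [isSimpleModule_iff_isAtom]
        refine ⟨by simpa using hv, fun N hN => ?_⟩
        by_contra hN0
        obtain ⟨x, hxN, hx0⟩ := (Submodule.ne_bot_iff _).1 hN0
        refine hN.not_ge ?_
        rw [Submodule.span_singleton_le_iff_mem]
        obtain ⟨r, rfl⟩ := Submodule.mem_span_singleton.1 (hN.le hxN)
        obtain ⟨s, hs⟩ := hl g r
        have hsm : s ∉ m := by
          intro hsm
          refine hx0 ?_
          simp only [v, ← map_smul, hs]
          exact (Submodule.Quotient.mk_eq_zero _).2 (I.mul_mem_left _ (hI s hsm))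
        obtain ⟨t, n, hn, htn⟩ := Ideal.IsMaximal.exists_inv ‹_› hsm
        obtain ⟨t', ht'⟩ := hr g t
        have key : v g = t' • r • v g := by
          simp only [v, ← map_smul]
          refine (Submodule.Quotient.eq _).2 ?_
          have h1 : t' • r • (u g : A) = u g * ((t * s) • (1 : A)) := by
            rw [hs, ← smul_mul_assoc, ← ht', mul_assoc, smul_mul_assoc, one_mul, smul_smul]
          have h2 : (u g : A) = u g * ((t * s + n) • (1 : A)) := by rw [htn]; simp
          rw [h1]
          nth_rw 1 [h2]
          rw [← mul_sub, ← sub_smul, add_sub_cancel_left]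
          exact I.mul_mem_left _ (hI n hn)
        rw [key]
        exact N.smul_mem _ hxN
      infer_instance
  · rw [← Submodule.span_iUnion, Set.iUnion_singleton_eq_range]
    have h1 : Set.range v = (I.restrictScalars R).mkQ '' Set.range fun g => (u g : A) := by
      rw [← Set.range_comp]
      rfl
    rw [h1, ← Submodule.map_span, hspan, Submodule.map_top, Submodule.range_mkQ]

/-- Let `A` be spanned over `R` by units `u g` normalizing `R` with `u g * u h ∈ Rˣ u (g h)`, where
`|G|` is invertible, and let the left ideal `I` of `A` contain a maximal left ideal of `R`. Then
`J(A) ⊆ I`: averaging an `R`-linear projection of `A / I` onto the image of `J(A)` makes it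
`A`-linear, hence given by right multiplication by an element of `J(A)`. -/
theorem jacobson_le_of_normalizing [Group G] [Fintype G] (hG : (Fintype.card G : k) ≠ 0)
    (hl : ∀ g (r : R), ∃ s : R, r • (u g : A) = u g * (s • (1 : A)))
    (hr : ∀ g (s : R), ∃ r : R, (u g : A) * (s • (1 : A)) = r • (u g : A))
    (hmul : ∀ g h, ∃ d : Rˣ, (u g : A) * u h = (d : R) • (u (g * h) : A))
    (hspan : Submodule.span R (Set.range fun g => (u g : A)) = ⊤)
    (m : Ideal R) [m.IsMaximal] (I : Ideal A) (hI : ∀ x ∈ m, x • (1 : A) ∈ I) :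
    Ring.jacobson A ≤ I := by
  have := isSemisimpleModule_quotient_of_normalizing hl hr hspan m I hI
  obtain ⟨q₀, hq₀, hqJ₀⟩ := exists_linearMap_quotient_eq_mkQ (I.restrictScalars R)
    ((Ring.jacobson A).restrictScalars R)
  let q : A →ₗ[R] A ⧸ I := (Submodule.Quotient.restrictScalarsEquiv R I).toLinearMap ∘ₗ q₀
  have hq : ∀ a, ∃ n ∈ Ring.jacobson A, q a = I.mkQ n := by
    intro a
    obtain ⟨n, hn, h⟩ := hq₀ a
    exact ⟨n, hn, by simp [q, h]⟩
  have hqJ : ∀ n ∈ Ring.jacobson A, q n = I.mkQ n := by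
    intro n hn
    simp [q, hqJ₀ n hn]
  -- The conjugate of `q` by `w`; it depends only on `w` modulo units of `R`.
  let T : Aˣ → A → A ⧸ I := fun w a => (w : A) • q (↑w⁻¹ * a)
  have hTmul : ∀ v w a, T (v * w) (v * a) = (v : A) • T w a := by
    intro v w a
    simp only [T, mul_inv_rev, Units.val_mul, mul_smul, mul_assoc, Units.inv_mul_cancel_left]
  have hTd : ∀ (w : Aˣ) g (d : Rˣ), (w : A) = (d : R) • (u g : A) → T w = T (u g) := by
    intro w g d hw
    obtain ⟨s, hs⟩ := hl g (↑d⁻¹ : R)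
    have h1 : (w : A) * (s • (1 : A)) = u g := by
      rw [hw, smul_mul_assoc, ← hs, smul_smul, Units.mul_inv, one_smul]
    have h2 : (↑w⁻¹ : A) = s • (↑(u g)⁻¹ : A) := by
      refine Units.inv_eq_of_mul_eq_one_right ?_
      rw [← one_mul (↑(u g)⁻¹ : A), ← smul_mul_assoc, ← mul_assoc, h1, Units.mul_inv]
    funext a
    simp only [T]
    rw [h2, smul_mul_assoc, map_smul, ← one_smul A (q _), ← smul_assoc s, smul_smul, h1,
      one_smul]
  have hTr : ∀ g (r : R) a, T (u g) (r • a) = r • T (u g) a := by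
    intro g r a
    obtain ⟨s, hs⟩ := hl g r
    have h1 : (↑(u g)⁻¹ : A) * (r • a) = s • (↑(u g)⁻¹ * a) := by
      rw [Units.inv_mul_eq_iff_eq_mul, ← one_mul (↑(u g)⁻¹ * a), ← smul_mul_assoc, ← mul_assoc,
        ← hs, smul_mul_assoc, Units.mul_inv_cancel_left]
    simp only [T]
    rw [h1, map_smul, ← smul_assoc r, hs, mul_smul, smul_assoc, one_smul]
  -- The sum of the conjugates of `q` is `A`-linear, and it is `|G|` times the class on `J(A)`.
  let F : A → A ⧸ I := fun a => ∑ g, T (u g) a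
  have hF : ∀ a b, F (a * b) = a • F b := by
    intro a
    have ha : a ∈ Submodule.span R (Set.range fun g => (u g : A)) := hspan ▸ Submodule.mem_top
    refine Submodule.span_induction ?_ ?_ ?_ ?_ ha
    · rintro _ ⟨h, rfl⟩ b
      simp only [F, Finset.smul_sum]
      rw [← Equiv.sum_comp (Equiv.mulLeft h)]
      refine Finset.sum_congr rfl fun g _ => ?_
      obtain ⟨d, hd⟩ := hmul h g
      rw [← hTmul, Equiv.coe_mulLeft, hTd (u h * u g) (h * g) d hd]
    · intro b
      simp [F, T]
    · intro x y _ _ hx hy b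
      rw [add_mul, add_smul, ← hx, ← hy]
      simp [F, T, mul_add, Finset.sum_add_distrib]
    · intro r x _ hx b
      rw [smul_assoc, ← hx, smul_mul_assoc]
      simp only [F, hTr, Finset.smul_sum]
  choose y hyJ hy using fun g => hq (↑(u g)⁻¹ * 1)
  have hF1 : F 1 = I.mkQ (∑ g, u g * y g) := by
    simp only [F, T, hy, map_sum, ← map_smul, smul_eq_mul]
  have hFJ : ∀ n ∈ Ring.jacobson A, F n = (Fintype.card G : k) • I.mkQ n := by
    intro n hn
    have h1 : ∀ g, T (u g) n = I.mkQ n := by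
      intro g
      simp only [T]
      rw [hqJ _ (Ideal.mul_mem_left _ _ hn), ← map_smul, smul_eq_mul, Units.mul_inv_cancel_left]
    simp only [F, h1]
    rw [Finset.sum_const, Finset.card_univ, ← Nat.cast_smul_eq_nsmul k]
  set z : A := (Fintype.card G : k)⁻¹ • ∑ g, u g * y g with hz
  have hzJ : z ∈ Ring.jacobson A :=
    Submodule.smul_of_tower_mem _ _ (sum_mem fun g _ => Ideal.mul_mem_left _ _ (hyJ g))
  have hsub : ∀ n ∈ Ring.jacobson A, n - n * z ∈ I := by
    intro n hn
    refine (Submodule.Quotient.eq I).1 ?_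
    have h1 := hFJ n hn
    rw [← mul_one n, hF, hF1, mul_one, ← map_smul, smul_eq_mul] at h1
    have h2 : I.mkQ (n * z) = (Fintype.card G : k)⁻¹ • I.mkQ (n * ∑ g, u g * y g) := by
      rw [hz, mul_smul_comm]
      rfl
    rw [h1, smul_smul, inv_mul_cancel₀ hG, one_smul] at h2
    exact h2.symm
  exact fun n hn => mem_of_sub_mul_mem I (Ring.jacobson A : Set A) (RingHom.id A) hzJ hzJ hsub hn

end Maschke

/-! ### Multiplication in the crossed product -/

namespace TwistedModuleAlgebra

variable {k : Type u} [Field k] {H : Type v} [Ring H] [HopfAlgebra k H]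
  {R : Type w} [Ring R] [Algebra k R]

theorem crossedMul_tmul_tmul (act : H →ₗ[k] R →ₗ[k] R) (σ : H ⊗[k] H →ₗ[k] R) (a b : R) (h l : H) :
    crossedMul act σ (a ⊗ₜ h) (b ⊗ₜ l) = a • twistPart act σ h b l := by
  simp [crossedMul]

theorem crossedMul_smul (act : H →ₗ[k] R →ₗ[k] R) (σ : H ⊗[k] H →ₗ[k] R) (a : R)
    (x y : R ⊗[k] H) : crossedMul act σ (a • x) y = a • crossedMul act σ x y := by
  induction x with
  | zero => simp
  | add x x' hx hx' => simp [smul_add, hx, hx']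
  | tmul b h => simp [crossedMul, TensorProduct.smul_tmul']

/-- The map `x ⊗ y ↦ (x · b) ∑ σ(y₁, l₁) # y₂ l₂`, whose value at `Δ h` is `(1 # h)(b # l)`. -/
def twistAux (act : H →ₗ[k] R →ₗ[k] R) (σ : H ⊗[k] H →ₗ[k] R) (b : R) (l : H) :
    H ⊗[k] H →ₗ[k] R ⊗[k] H :=
  TensorProduct.lift ((Algebra.lsmul k k (R ⊗[k] H)).toLinearMap.compl₁₂ (act.flip b)
    (cocyclePart σ ∘ₗ (TensorProduct.mk k H H).flip l))

theorem twistAux_tmul (act : H →ₗ[k] R →ₗ[k] R) (σ : H ⊗[k] H →ₗ[k] R) (b : R) (l x y : H) :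
    twistAux act σ b l (x ⊗ₜ y) = act x b • cocyclePart σ (y ⊗ₜ l) := rfl

theorem twistPart_apply (act : H →ₗ[k] R →ₗ[k] R) (σ : H ⊗[k] H →ₗ[k] R) (b : R) (h l : H) :
    twistPart act σ h b l = twistAux act σ b l (comul h) := by
  rw [twistPart, LinearMap.comp_apply]
  induction comul (R := k) h with
  | zero => simp
  | add x y hx hy => simp [hx, hy]
  | tmul x y => rfl

variable (D : TwistedModuleAlgebra k H R)

instance : Module R D.CrossedProduct := inferInstanceAs (Module R (R ⊗[k] H))

instance : IsScalarTower k R D.CrossedProduct := inferInstanceAs (IsScalarTower k R (R ⊗[k] H))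

/-- The element `a # h` of the crossed product. -/
def elt (a : R) : H →ₗ[k] D.CrossedProduct := TensorProduct.mk k R H a

instance : IsScalarTower R D.CrossedProduct D.CrossedProduct :=
  ⟨fun a x y => crossedMul_smul D.act D.σ a x y⟩

theorem elt_eq_smul (a : R) (h : H) : D.elt a h = a • D.elt 1 h := by
  change a ⊗ₜ[k] h = a • ((1 : R) ⊗ₜ[k] h)
  rw [TensorProduct.smul_tmul', smul_eq_mul, mul_one]

theorem one_eq_elt : (1 : D.CrossedProduct) = D.elt 1 1 := rfl

theorem elt_mul_elt (a b : R) (h l : H) :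
    D.elt a h * D.elt b l = a • (twistAux D.act D.σ b l (comul h) : D.CrossedProduct) := by
  rw [← twistPart_apply]
  exact crossedMul_tmul_tmul D.act D.σ a b h l

theorem cocyclePart_one_tmul (l : H) : cocyclePart D.σ (1 ⊗ₜ l) = (1 : R) ⊗ₜ[k] l := by
  have h := D.one_crossed (1 ⊗ₜ l)
  rw [crossedMul_tmul_tmul, twistPart_apply, Bialgebra.comul_one,
    Algebra.TensorProduct.one_def, twistAux_tmul, D.one_act, one_smul, one_smul] at h
  exact h

/-- `(a # 1)(b # l) = a b # l`. -/
theorem elt_one_mul_elt (a b : R) (l : H) : D.elt a 1 * D.elt b l = D.elt (a * b) l := by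
  rw [elt_mul_elt, Bialgebra.comul_one, Algebra.TensorProduct.one_def, twistAux_tmul, D.one_act,
    cocyclePart_one_tmul]
  change a • b • ((1 : R) ⊗ₜ[k] l) = (a * b) ⊗ₜ[k] l
  simp [TensorProduct.smul_tmul']

/-- The embedding `a ↦ a # 1` of `R` into the crossed product. -/
def incl : R →ₐ[k] D.CrossedProduct where
  toFun a := D.elt a 1
  map_one' := rfl
  map_mul' a b := (D.elt_one_mul_elt a b 1).symm
  map_zero' := TensorProduct.zero_tmul _ _
  map_add' a b := TensorProduct.add_tmul _ _ _
  commutes' c := by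
    rw [Algebra.algebraMap_eq_smul_one, Algebra.algebraMap_eq_smul_one]
    exact (TensorProduct.smul_tmul' c (1 : R) (1 : H)).symm

theorem incl_apply (a : R) : D.incl a = D.elt a 1 := rfl

theorem incl_eq_smul_one (a : R) : D.incl a = a • (1 : D.CrossedProduct) := D.elt_eq_smul a 1

theorem incl_mul (a : R) (x : D.CrossedProduct) : D.incl a * x = a • x := by
  rw [incl_apply, elt_eq_smul, smul_mul_assoc, ← one_eq_elt, one_mul]

/-- For a functional `f` on `H`, the left `R`-linear map `id ⊗ f`. -/
def coef (f : H →ₗ[k] k) : D.CrossedProduct →ₗ[k] R :=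
  (TensorProduct.rid k R).toLinearMap ∘ₗ TensorProduct.map LinearMap.id f

theorem coef_elt (f : H →ₗ[k] k) (a : R) (h : H) : D.coef f (D.elt a h) = f h • a := by
  change TensorProduct.rid k R (TensorProduct.map LinearMap.id f (a ⊗ₜ[k] h)) = _
  simp

@[elab_as_elim]
theorem crossed_induction {P : D.CrossedProduct → Prop} (x : D.CrossedProduct)
    (zero : P 0) (elt : ∀ a h, P (D.elt a h)) (add : ∀ x y, P x → P y → P (x + y)) : P x :=
  TensorProduct.induction_on x zero elt add

theorem coef_smul (f : H →ₗ[k] k) (a : R) (x : D.CrossedProduct) :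
    D.coef f (a • x) = a * D.coef f x := by
  induction x using D.crossed_induction with
  | zero => simp
  | add x y hx hy => simp [smul_add, mul_add, hx, hy]
  | elt b h =>
    rw [elt_eq_smul, smul_smul, ← elt_eq_smul, ← elt_eq_smul, coef_elt, coef_elt, mul_smul_comm]

theorem coef_counit_cocyclePart (z : H ⊗[k] H) :
    D.coef counit (cocyclePart D.σ z : R ⊗[k] H) = D.σ z := by
  have h1 : (counit : H →ₗ[k] k) ∘ₗ LinearMap.mul' k H = counit := by
    ext x y
    simp [TensorProduct.counit_tmul, mul_comm]
  change TensorProduct.rid k R (TensorProduct.map LinearMap.id counit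
    (TensorProduct.map D.σ (LinearMap.mul' k H) (comul z))) = _
  have h2 : TensorProduct.map D.σ (counit (R := k) (A := H ⊗[k] H)) =
      TensorProduct.map D.σ LinearMap.id ∘ₗ
        LinearMap.lTensor (H ⊗[k] H) (counit (R := k) (A := H ⊗[k] H)) := by
    rw [LinearMap.lTensor, ← TensorProduct.map_comp, LinearMap.comp_id, LinearMap.id_comp]
  rw [← LinearMap.comp_apply, ← TensorProduct.map_comp, h1, LinearMap.id_comp, h2,
    LinearMap.comp_apply, Coalgebra.lTensor_counit_comul]
  simp

/-- `h · 1 = ε(h) 1`: in the convolution algebra `h ↦ h · 1` is idempotent because the action is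
multiplicative, and right invertible because `1 # 1` is a right unit. -/
theorem act_one (h : H) : D.act h 1 = algebraMap k R (counit h) := by
  let f : WithConv (H →ₗ[k] R) := toConv (D.act.flip 1)
  let s : WithConv (H →ₗ[k] R) := toConv (D.σ ∘ₗ (TensorProduct.mk k H H).flip 1)
  have hff : f * f = f := by
    ext x
    change (f * f) x = D.act x 1
    rw [← D.act_mul, one_mul]
  have hfs : f * s = 1 := by
    ext x
    have h1 : D.coef counit (D.elt 1 x * D.elt 1 1) = D.coef counit (D.elt 1 x) := by
      rw [← one_eq_elt, mul_one]
    rw [elt_mul_elt, one_smul, coef_elt, ← Algebra.algebraMap_eq_smul_one] at h1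
    rw [LinearMap.convMul_apply, LinearMap.convOne_apply, ← h1]
    induction comul (R := k) x with
    | zero =>
      rw [map_zero, map_zero, map_zero]
      exact (map_zero (D.coef counit)).symm
    | add y z hy hz =>
      rw [map_add, map_add, hy, hz, map_add]
      exact (map_add (D.coef counit) _ _).symm
    | tmul y z =>
      rw [twistAux_tmul]
      refine Eq.trans ?_ (D.coef_smul counit _ _).symm
      rw [coef_counit_cocyclePart]
      rfl
  have hf : f = 1 := by
    rw [← mul_one f, ← hfs, ← mul_assoc, hff]
  exact congr($hf h)

theorem twistAux_one (h l : H) : twistAux D.act D.σ 1 l (comul h) = cocyclePart D.σ (h ⊗ₜ l) := by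
  have h1 : ∀ z : H ⊗[k] H, twistAux D.act D.σ 1 l z =
      cocyclePart D.σ (TensorProduct.lid k H (TensorProduct.map counit LinearMap.id z) ⊗ₜ l) := by
    intro z
    induction z with
    | zero => simp
    | add y z hy hz => simp only [map_add, hy, hz, TensorProduct.add_tmul]
    | tmul y z =>
      rw [twistAux_tmul, act_one, algebraMap_smul]
      simp [← TensorProduct.smul_tmul']
  rw [h1]
  have h2 := Coalgebra.rTensor_counit_comul (R := k) h
  rw [LinearMap.rTensor] at h2
  rw [h2]
  simp

/-- `(1 # h)(1 # l) = ∑ σ(h₁, l₁) # h₂ l₂`. -/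
theorem elt_one_mul_elt_one (h l : H) :
    D.elt 1 h * D.elt 1 l = (cocyclePart D.σ (h ⊗ₜ l) : R ⊗[k] H) := by
  rw [elt_mul_elt, one_smul, twistAux_one]

theorem cocyclePart_tmul_one (h : H) : cocyclePart D.σ (h ⊗ₜ 1) = (1 : R) ⊗ₜ[k] h := by
  rw [← elt_one_mul_elt_one, ← one_eq_elt, mul_one]
  rfl

/-- `(1 # h)(b # 1) = ∑ (h₁ · b) # h₂`. -/
theorem elt_mul_incl (h : H) (b : R) :
    D.elt 1 h * D.incl b = (TensorProduct.map (D.act.flip b) LinearMap.id (comul h) : R ⊗[k] H) := by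
  rw [incl_apply, elt_mul_elt, one_smul]
  induction comul (R := k) h with
  | zero => simp; rfl
  | add y z hy hz => rw [map_add, map_add, ← hy, ← hz]
  | tmul y z =>
    rw [twistAux_tmul, cocyclePart_tmul_one, TensorProduct.smul_tmul', smul_eq_mul, mul_one]
    rfl

theorem elt_mem_crossedSubspace {I : Submodule k R} {a : R} (ha : a ∈ I) (h : H) :
    D.elt a h ∈ D.crossedSubspace I :=
  Submodule.subset_span ⟨a, ha, h, rfl⟩

theorem coef_mem_of_mem_crossedSubspace {I : Submodule k R} {x : D.CrossedProduct}
    (hx : x ∈ D.crossedSubspace I) (f : H →ₗ[k] k) : D.coef f x ∈ I := by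
  refine Submodule.span_induction ?_ ?_ ?_ ?_ hx
  · rintro _ ⟨a, ha, h, rfl⟩
    change D.coef f (D.elt a h) ∈ I
    rw [coef_elt]
    exact I.smul_mem _ ha
  · simp
  · intro x y _ _ hx hy
    rw [map_add]
    exact I.add_mem hx hy
  · intro c x _ hx
    rw [LinearMap.map_smul_of_tower]
    exact I.smul_mem _ hx

/-! ### Comparison of the radicals for finite-dimensional `H` -/

theorem comap_jacobson_le : (Ring.jacobson D.CrossedProduct).comap D.incl ≤ Ring.jacobson R := by
  refine comap_jacobson_le_of_retraction D.incl.toRingHom (D.coef counit).toAddMonoidHom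
    (fun r a => ?_) ?_
  · change D.coef counit (D.incl r * a) = r * D.coef counit a
    rw [incl_mul, coef_smul]
  · change D.coef counit (D.elt 1 1) = 1
    rw [coef_elt, Bialgebra.counit_one, one_smul]

theorem crossedSubspace_le_jac {I : Submodule k R}
    (hI : ∀ a ∈ I, D.incl a ∈ Ring.jacobson D.CrossedProduct) :
    D.crossedSubspace I ≤ jac k D.CrossedProduct := by
  refine Submodule.span_le.2 ?_
  rintro _ ⟨a, ha, h, rfl⟩
  change D.elt a h ∈ Ring.jacobson D.CrossedProduct
  rw [elt_eq_smul, ← incl_mul]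
  exact Ideal.mul_mem_right _ _ (hI a ha)

/-- A module over the crossed product is an `R`-`H`-module, with `h m = (1 # h) m`. -/
def toRHModule (V : Type*) [AddCommGroup V] [Module k V] [Module D.CrossedProduct V]
    [IsScalarTower k D.CrossedProduct V] [Module R V] [IsScalarTower k R V]
    [IsScalarTower R D.CrossedProduct V] : RHModule D V where
  act := (Algebra.lsmul k k V).toLinearMap ∘ₗ D.elt 1
  one_act m := one_smul _ m
  act_smul h a m := by
    change D.elt 1 h • a • m = _
    have h1 : a • m = D.incl a • m := by
      rw [← mul_one (D.incl a), incl_mul, smul_assoc, one_smul]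
    rw [h1, smul_smul, elt_mul_incl]
    induction comul (R := k) h with
    | zero =>
      rw [map_zero, map_zero]
      exact zero_smul D.CrossedProduct m
    | add y z hy hz =>
      rw [map_add, map_add, ← hy, ← hz]
      exact add_smul (R := D.CrossedProduct) _ _ m
    | tmul y z =>
      change D.elt (D.act y a) z • m = D.act y a • D.elt 1 z • m
      rw [elt_eq_smul, smul_assoc]
  act_act h l m := by
    change D.elt 1 h • D.elt 1 l • m = _
    rw [smul_smul, elt_one_mul_elt_one, cocyclePart, LinearMap.comp_apply]
    induction comul (R := k) (h ⊗ₜ[k] l) with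
    | zero =>
      rw [map_zero, map_zero]
      exact zero_smul D.CrossedProduct m
    | add y z hy hz =>
      rw [map_add, map_add, ← hy, ← hz]
      exact add_smul (R := D.CrossedProduct) _ _ m
    | tmul y z =>
      change D.elt (D.σ y) (LinearMap.mul' k H z) • m = D.σ y • D.elt 1 (LinearMap.mul' k H z) • m
      rw [elt_eq_smul, smul_assoc]

/-- `r_{Hj}(R) ⊆ J(A) ∩ R`, because simple modules over the crossed product `A` are irreducible
`R`-`H`-modules. -/
theorem hJacobson_le (x : R) (hx : x ∈ D.hJacobson) :
    D.incl x ∈ Ring.jacobson D.CrossedProduct := by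
  rw [Ring.jacobson_eq_sInf_isMaximal, Submodule.mem_sInf]
  intro m (hm : Ideal.IsMaximal m)
  have : IsSimpleModule D.CrossedProduct (D.CrossedProduct ⧸ m) :=
    isSimpleModule_iff_isCoatom.2 (Ideal.isMaximal_def.1 hm)
  have hann : x ∈ Module.annihilator R (D.CrossedProduct ⧸ m) := by
    refine (Submodule.mem_sInf.1 hx) _ ⟨D.CrossedProduct ⧸ m, inferInstance, inferInstance,
      inferInstance, inferInstance, D.toRHModule _, ⟨IsSimpleModule.nontrivial D.CrossedProduct _,
        fun N hN => ?_⟩, rfl⟩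
    let N' : Submodule D.CrossedProduct (D.CrossedProduct ⧸ m) :=
      { N with
        smul_mem' := by
          intro a n hn
          induction a using D.crossed_induction with
          | zero => simp
          | add a b ha hb =>
            rw [add_smul]
            exact N.add_mem ha hb
          | elt a h =>
            rw [elt_eq_smul, smul_assoc]
            exact N.smul_mem _ (hN h n hn) }
    have hmem : ∀ n, n ∈ N' ↔ n ∈ N := fun n => Iff.rfl
    refine (eq_bot_or_eq_top N').imp (fun h => ?_) fun h => ?_
    · ext n
      rw [← hmem, h, Submodule.mem_bot, Submodule.mem_bot]
    · ext n
      rw [← hmem, h]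
      simp
  have h1 := Module.mem_annihilator.1 hann (Submodule.Quotient.mk 1)
  rw [← Submodule.Quotient.mk_smul, Submodule.Quotient.mk_eq_zero] at h1
  rwa [← mul_one (D.incl x), incl_mul]

/-- If `J(R)` is `H`-stable, it annihilates every irreducible `R`-`H`-module `M`: the `R`-`H`-submodule
`J(R) M` differs from `M` by Nakayama's lemma, `M` being finitely generated over `R`. -/
theorem jac_le_hJacobson [Module.Finite k H]
    (hst : ∀ h : H, ∀ x ∈ jac k R, D.act h x ∈ jac k R) : jac k R ≤ D.hJacobson := by
  intro x hx
  refine Submodule.mem_sInf.2 ?_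
  rintro _ ⟨M, _, _, _, _, A, ⟨hM, hirr⟩, rfl⟩
  have key : Ring.jacobson R • (⊤ : Submodule R M) = ⊥ := by
    have hfin : Module.Finite R M := by
      obtain ⟨m, hm⟩ := exists_ne (0 : M)
      obtain ⟨S, hS⟩ := Module.Finite.fg_top (R := k) (M := H)
      let N : Submodule R M := Submodule.span R ((fun h => A.act h m) '' (S : Set H))
      have hN : ∀ h, A.act h m ∈ N := by
        intro h
        have hh : h ∈ Submodule.span k (S : Set H) := hS ▸ Submodule.mem_top
        refine Submodule.span_induction ?_ ?_ ?_ ?_ hh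
        · intro h hh
          exact Submodule.subset_span ⟨h, hh, rfl⟩
        · simp
        · intro x y _ _ hx hy
          rw [map_add]
          exact N.add_mem hx hy
        · intro c x _ hx
          rw [map_smul]
          exact N.smul_of_tower_mem c hx
      have hN' := hirr N (by
        intro h n hn
        induction hn using Submodule.span_induction generalizing h with
        | mem n hn =>
          obtain ⟨l, _, rfl⟩ := hn
          change A.act h (A.act l m) ∈ N
          rw [A.act_act]
          induction comul (R := k) (h ⊗ₜ[k] l) with
          | zero => simp
          | add y z hy hz =>
            rw [map_add]
            exact N.add_mem hy hz
          | tmul y z => exact N.smul_mem _ (hN _)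
        | zero => simp
        | add x y _ _ hx hy =>
          rw [map_add]
          exact N.add_mem (hx h) (hy h)
        | smul a x _ hx =>
          rw [A.act_smul]
          induction comul (R := k) h with
          | zero => simp
          | add y z hy hz =>
            rw [map_add]
            exact N.add_mem hy hz
          | tmul y z => exact N.smul_mem _ (hx _))
      have hN0 : N ≠ ⊥ := by
        refine (Submodule.ne_bot_iff _).2 ⟨m, ?_, hm⟩
        rw [← A.one_act m]
        exact hN 1
      exact ⟨hN'.resolve_left hN0 ▸ Submodule.fg_span (S.finite_toSet.image _)⟩
    refine (hirr (Ring.jacobson R • ⊤) fun h n hn => ?_).resolve_right fun h => ?_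
    · induction hn using Submodule.smul_induction_on' with
      | smul a ha n hn =>
        rw [A.act_smul]
        induction comul (R := k) h with
        | zero => simp
        | add y z hy hz =>
          rw [map_add]
          exact Submodule.add_mem _ hy hz
        | tmul y z => exact Submodule.smul_mem_smul (hst y a ha) Submodule.mem_top
      | add x _ y _ hx hy =>
        rw [map_add]
        exact Submodule.add_mem _ hx hy
    · exact top_ne_bot (Submodule.FG.eq_bot_of_le_jacobson_smul Module.Finite.fg_top h.ge)
  refine Module.mem_annihilator.2 fun m => ?_
  have h1 : x • m ∈ Ring.jacobson R • (⊤ : Submodule R M) :=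
    Submodule.smul_mem_smul hx Submodule.mem_top
  rwa [key, Submodule.mem_bot] at h1

/-- The comparison of radicals, reduced to the `H`-stability of `J(R)` and `J(A) ⊆ J(R) # H`. -/
theorem radicals_eq [Module.Finite k H]
    (hst : ∀ h : H, ∀ x ∈ jac k R, D.act h x ∈ jac k R)
    (hA : jac k D.CrossedProduct ≤ D.crossedSubspace (jac k R)) :
    jac k R = D.hJacobson ∧ D.hJacobson = D.jacobsonH ∧
      (∀ h : H, ∀ x ∈ jac k R, D.act h x ∈ jac k R) ∧
      jac k D.CrossedProduct = D.crossedSubspace D.hJacobson := by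
  have h1 : jac k R = D.hJacobson :=
    le_antisymm (D.jac_le_hJacobson hst) fun x hx => D.comap_jacobson_le (D.hJacobson_le x hx)
  refine ⟨h1, ?_, hst, ?_⟩
  · rw [← h1]
    refine le_antisymm (fun x hx h => hst h x hx) fun x hx => ?_
    have := hx 1
    rwa [D.one_act] at this
  · rw [← h1]
    refine le_antisymm hA (D.crossedSubspace_le_jac fun a ha => D.hJacobson_le a ?_)
    rwa [← h1]

/-! ### Crossed products with the group algebra -/

section GroupAlgebra

variable {k : Type u} [Field k] {G : Type v} [Group G] {R : Type w} [Ring R] [Algebra k R]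
  (D : TwistedModuleAlgebra k (MonoidAlgebra k G) R)

theorem comul_single_one {G : Type*} (g : G) : comul (R := k) (MonoidAlgebra.single g (1 : k)) =
    MonoidAlgebra.single g (1 : k) ⊗ₜ[k] MonoidAlgebra.single g (1 : k) := by
  simp

theorem comul_single_tmul_single {G : Type*} (g h : G) :
    comul (R := k) (MonoidAlgebra.single g (1 : k) ⊗ₜ[k] MonoidAlgebra.single h (1 : k)) =
      (MonoidAlgebra.single g (1 : k) ⊗ₜ[k] MonoidAlgebra.single h (1 : k)) ⊗ₜ[k]
        (MonoidAlgebra.single g (1 : k) ⊗ₜ[k] MonoidAlgebra.single h (1 : k)) := by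
  rw [TensorProduct.comul_tmul, comul_single_one, comul_single_one]
  rfl

/-- The value `σ(g, h)` at group elements, a unit with inverse `σ⁻¹(g, h)`. -/
def sigmaUnit (g h : G) : Rˣ where
  val := D.σ (MonoidAlgebra.single g 1 ⊗ₜ MonoidAlgebra.single h 1)
  inv := D.σinv (MonoidAlgebra.single g 1 ⊗ₜ MonoidAlgebra.single h 1)
  val_inv := by
    have h1 := congr($(D.σ_mul_σinv) (MonoidAlgebra.single g 1 ⊗ₜ MonoidAlgebra.single h 1))
    rw [LinearMap.convMul_apply, comul_single_tmul_single, LinearMap.convOne_apply] at h1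
    simpa [TensorProduct.counit_tmul] using h1
  inv_val := by
    have h1 := congr($(D.σinv_mul_σ) (MonoidAlgebra.single g 1 ⊗ₜ MonoidAlgebra.single h 1))
    rw [LinearMap.convMul_apply, comul_single_tmul_single, LinearMap.convOne_apply] at h1
    simpa [TensorProduct.counit_tmul] using h1

/-- The element `1 # g`. -/
def groupElt (g : G) : D.CrossedProduct := D.elt 1 (MonoidAlgebra.single g 1)

theorem groupElt_one : D.groupElt 1 = 1 := rfl

theorem groupElt_mul (g h : G) :
    D.groupElt g * D.groupElt h = (D.sigmaUnit g h : R) • D.groupElt (g * h) := by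
  rw [groupElt, groupElt, elt_one_mul_elt_one, cocyclePart, LinearMap.comp_apply,
    comul_single_tmul_single, TensorProduct.map_tmul, LinearMap.mul'_apply,
    MonoidAlgebra.single_mul_single, mul_one]
  exact D.elt_eq_smul _ _

theorem groupElt_mul_incl (g : G) (r : R) :
    D.groupElt g * D.incl r = D.act (MonoidAlgebra.single g 1) r • D.groupElt g := by
  rw [groupElt, elt_mul_incl, comul_single_one, TensorProduct.map_tmul]
  exact D.elt_eq_smul _ _

theorem act_single_act_single (g h : G) (r : R) :
    D.act (MonoidAlgebra.single g 1) (D.act (MonoidAlgebra.single h 1) r) =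
      D.sigmaUnit g h * D.act (MonoidAlgebra.single (g * h) 1) r * ↑(D.sigmaUnit g h)⁻¹ := by
  rw [D.act_act, LinearMap.convMul_apply, comul_single_tmul_single]
  simp only [TensorProduct.map_tmul, LinearMap.mul'_apply, LinearMap.convMul_apply,
    comul_single_tmul_single]
  simp [sigmaUnit]

/-- Acting by `g` and `g⁻¹` in succession is conjugation by the unit `σ(g, g⁻¹)`. -/
theorem act_single_surjective (g : G) :
    Function.Surjective (D.act (MonoidAlgebra.single g 1)) := by
  intro s
  refine ⟨D.act (MonoidAlgebra.single g⁻¹ 1)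
    (↑(D.sigmaUnit g g⁻¹)⁻¹ * s * D.sigmaUnit g g⁻¹), ?_⟩
  rw [act_single_act_single, mul_inv_cancel]
  have h1 := D.one_act (↑(D.sigmaUnit g g⁻¹)⁻¹ * s * D.sigmaUnit g g⁻¹)
  rw [MonoidAlgebra.one_def] at h1
  rw [h1]
  simp [mul_assoc]

/-- The action of a group element on `R`, as a ring homomorphism. -/
def actHom (g : G) : R →+* R where
  toFun := D.act (MonoidAlgebra.single g 1)
  map_one' := by rw [act_one]; simp
  map_mul' r s := by
    rw [D.act_mul, LinearMap.convMul_apply, comul_single_one]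
    rfl
  map_zero' := map_zero _
  map_add' := map_add _

theorem act_mem_jac_of_mem_jac (h : MonoidAlgebra k G) (x : R) (hx : x ∈ jac k R) :
    D.act h x ∈ jac k R := by
  induction h using MonoidAlgebra.induction_linear with
  | zero => simp
  | add f g hf hg =>
    rw [map_add]
    exact Submodule.add_mem _ hf hg
  | single g c =>
    have h1 : (MonoidAlgebra.single g c : MonoidAlgebra k G) = c • MonoidAlgebra.single g 1 := by
      simp
    rw [h1, map_smul]
    refine Submodule.smul_mem _ _ ?_
    have : RingHomSurjective (D.actHom g) := ⟨D.act_single_surjective g⟩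
    exact Ring.le_comap_jacobson (D.actHom g) hx

theorem isUnit_groupElt (g : G) : IsUnit (D.groupElt g) := by
  have hright : D.groupElt g * (D.groupElt g⁻¹ * D.incl ↑(D.sigmaUnit g g⁻¹)⁻¹) = 1 := by
    rw [← mul_assoc, groupElt_mul, mul_inv_cancel, groupElt_one, ← incl_eq_smul_one, ← map_mul,
      Units.mul_inv, map_one]
  have hleft : D.incl ↑(D.sigmaUnit g⁻¹ g)⁻¹ * D.groupElt g⁻¹ * D.groupElt g = 1 := by
    rw [mul_assoc, groupElt_mul, inv_mul_cancel, groupElt_one, ← incl_eq_smul_one, ← map_mul,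
      Units.inv_mul, map_one]
  exact ⟨⟨_, _, hright, by rw [← left_inv_eq_right_inv hleft hright, hleft]⟩, rfl⟩

/-- The functional on `kG` reading the coefficient of `g`. -/
def coeffAt {G : Type*} (g : G) : MonoidAlgebra k G →ₗ[k] k :=
  Finsupp.lapply g ∘ₗ (MonoidAlgebra.coeffLinearEquiv k).toLinearMap

theorem coeffAt_single {G : Type*} [DecidableEq G] (g h : G) (c : k) :
    coeffAt g (MonoidAlgebra.single h c) = if h = g then c else 0 := by
  simp [coeffAt, Finsupp.single_apply]

theorem coef_smul_groupElt [DecidableEq G] (g h : G) (r : R) :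
    D.coef (coeffAt g) (r • D.groupElt h) = if h = g then r else 0 := by
  rw [groupElt, ← elt_eq_smul, coef_elt, coeffAt_single]
  split_ifs <;> simp

theorem elt_single (r : R) (h : G) (c : k) :
    D.elt r (MonoidAlgebra.single h c) = (c • r) • D.groupElt h := by
  have h1 : (MonoidAlgebra.single h c : MonoidAlgebra k G) = c • MonoidAlgebra.single h 1 := by
    simp
  rw [h1, map_smul, elt_eq_smul, smul_assoc]
  rfl

theorem sum_coef_smul_groupElt [Fintype G] (x : D.CrossedProduct) :
    ∑ g, D.coef (coeffAt g) x • D.groupElt g = x := by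
  classical
  induction x using D.crossed_induction with
  | zero => simp
  | add x y hx hy => simp only [map_add, add_smul, Finset.sum_add_distrib, hx, hy]
  | elt a h =>
    induction h using MonoidAlgebra.induction_linear with
    | zero => simp
    | add f g hf hg => simp only [map_add, add_smul, Finset.sum_add_distrib, hf, hg]
    | single g c => simp [elt_single, coef_smul_groupElt, ite_smul]

theorem coef_mul_incl [Fintype G] (g : G) (x : D.CrossedProduct) (s : R) :
    D.coef (coeffAt g) (x * D.incl s) =
      D.coef (coeffAt g) x * D.act (MonoidAlgebra.single g 1) s := by
  classical
  conv_lhs => rw [← D.sum_coef_smul_groupElt x]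
  simp only [Finset.sum_mul, smul_mul_assoc, groupElt_mul_incl, smul_smul, map_sum,
    coef_smul_groupElt]
  simp

theorem coef_mem_of_mem_jac [Fintype G] (hG : ((Fintype.card G : ℕ) : k) ≠ 0)
    {x : D.CrossedProduct} (hx : x ∈ Ring.jacobson D.CrossedProduct) (g : G) :
    D.coef (coeffAt g) x ∈ Ring.jacobson R := by
  rw [Ring.jacobson_eq_sInf_isMaximal, Submodule.mem_sInf]
  intro m (hm : Ideal.IsMaximal m)
  have hm' : (Ideal.comap (D.actHom g) m).IsMaximal :=
    Ideal.comap_isMaximal_of_surjective (D.actHom g) (D.act_single_surjective g)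
  have hxI : x ∈ Ideal.span (D.incl '' (Ideal.comap (D.actHom g) m : Set R)) := by
    refine jacobson_le_of_normalizing (R := R) (u := fun g => (D.isUnit_groupElt g).unit) hG
      (fun g r => ?_) (fun g s => ?_) (fun g h => ?_) ?_ (Ideal.comap (D.actHom g) m) _
      (fun r hr => ?_) hx
    · obtain ⟨s, rfl⟩ := D.act_single_surjective g r
      exact ⟨s, by rw [IsUnit.unit_spec, ← incl_eq_smul_one, groupElt_mul_incl]⟩
    · exact ⟨_, by rw [IsUnit.unit_spec, ← incl_eq_smul_one, groupElt_mul_incl]⟩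
    · exact ⟨D.sigmaUnit g h, D.groupElt_mul g h⟩
    · rw [eq_top_iff]
      intro y _
      rw [← D.sum_coef_smul_groupElt y]
      exact sum_mem fun h _ => Submodule.smul_mem _ _ (Submodule.subset_span ⟨h, rfl⟩)
    · rw [← incl_eq_smul_one]
      exact Ideal.subset_span ⟨r, hr, rfl⟩
  -- The quantifier over `b` makes the statement stable under left multiplication.
  suffices h : ∀ b, D.coef (coeffAt g) (b * x) ∈ m by simpa using h 1
  refine Submodule.span_induction ?_ ?_ ?_ ?_ hxI
  · rintro _ ⟨r, hr, rfl⟩ b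
    rw [coef_mul_incl]
    exact Ideal.mul_mem_left _ _ hr
  · simp
  · intro y z _ _ hy hz b
    rw [mul_add, map_add]
    exact Submodule.add_mem _ (hy b) (hz b)
  · intro a y _ hy b
    rw [smul_eq_mul, ← mul_assoc]
    exact hy (b * a)

theorem jac_crossedProduct_le [Fintype G] (hG : ((Fintype.card G : ℕ) : k) ≠ 0) :
    jac k D.CrossedProduct ≤ D.crossedSubspace (jac k R) := by
  intro x hx
  rw [← D.sum_coef_smul_groupElt x]
  refine sum_mem fun g _ => ?_
  rw [groupElt, ← elt_eq_smul]
  exact D.elt_mem_crossedSubspace (D.coef_mem_of_mem_jac hG hx g) _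

end GroupAlgebra

/-! ### Crossed products with the dual of the group algebra -/

section GroupDual

open GroupDual

variable {k : Type u} [Field k] {G : Type v} [Group G] [Fintype G] [DecidableEq G] {R : Type w}
  [Ring R] [Algebra k R] (D : TwistedModuleAlgebra k (GroupDual k G) R)

theorem comul_p_tmul_p (g h : G) : comul (R := k) (p k g ⊗ₜ[k] p k h) =
    ∑ x, ∑ y, (p k x ⊗ₜ[k] p k y) ⊗ₜ[k] (p k (x⁻¹ * g) ⊗ₜ[k] p k (y⁻¹ * h)) := by
  rw [TensorProduct.comul_tmul, comul_p, comul_p]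
  simp only [TensorProduct.sum_tmul, TensorProduct.tmul_sum, map_sum]
  rw [Finset.sum_comm]
  rfl

theorem sum_sigmaInv_mul_sigma (g h : G) :
    ∑ x, ∑ y, D.σinv (p k x ⊗ₜ p k y) * D.σ (p k (x⁻¹ * g) ⊗ₜ p k (y⁻¹ * h)) =
      if g = 1 ∧ h = 1 then 1 else 0 := by
  have h1 := congr($(D.σinv_mul_σ) (p k g ⊗ₜ p k h))
  rw [LinearMap.convMul_apply, comul_p_tmul_p, LinearMap.convOne_apply] at h1
  simp only [map_sum, TensorProduct.map_tmul, LinearMap.mul'_apply, TensorProduct.counit_tmul,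
    counit_eq, eval_p] at h1
  refine h1.trans ?_
  by_cases hg : g = 1 <;> by_cases hh : h = 1 <;> simp [hg, hh, eq_comm]

/-- The element `1 # p_g`. -/
def dualElt (g : G) : D.CrossedProduct := D.elt 1 (p k g)

theorem sum_dualElt : ∑ g, D.dualElt g = 1 := by
  simp only [dualElt]
  rw [← map_sum, sum_p, one_eq_elt]

theorem dualElt_mul (g h : G) : D.dualElt g * D.dualElt h =
    ∑ t, D.σ (p k (g * t⁻¹) ⊗ₜ p k (h * t⁻¹)) • D.dualElt t := by
  rw [dualElt, dualElt, elt_one_mul_elt_one, cocyclePart, LinearMap.comp_apply, comul_p_tmul_p]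
  simp only [map_sum, TensorProduct.map_tmul, LinearMap.mul'_apply, p_mul_p,
    TensorProduct.tmul_ite]
  rw [← Equiv.sum_comp ((Equiv.inv G).trans (Equiv.mulLeft g))]
  refine Finset.sum_congr rfl fun t _ => ?_
  rw [Finset.sum_eq_single (h * t⁻¹)]
  · simp only [Equiv.trans_apply, Equiv.inv_apply, Equiv.coe_mulLeft, mul_inv_rev, inv_inv,
      mul_assoc, inv_mul_cancel, mul_one, if_true]
    exact D.elt_eq_smul _ _
  · intro y _ hy
    rw [if_neg]
    intro h1
    refine hy ?_
    simp only [Equiv.trans_apply, Equiv.inv_apply, Equiv.coe_mulLeft, mul_inv_rev, inv_inv,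
      mul_assoc, inv_mul_cancel, mul_one] at h1
    rw [h1]
    simp
  · simp

theorem dualElt_mul_incl (g : G) (b : R) :
    D.dualElt g * D.incl b = ∑ x, D.act (p k x) b • D.dualElt (x⁻¹ * g) := by
  rw [dualElt, elt_mul_incl, comul_p]
  simp only [map_sum, TensorProduct.map_tmul]
  exact Finset.sum_congr rfl fun x _ => D.elt_eq_smul _ _

theorem coef_smul_dualElt (g h : G) (r : R) :
    D.coef (eval k g) (r • D.dualElt h) = if g = h then r else 0 := by
  rw [dualElt, ← elt_eq_smul, coef_elt, eval_p]
  split_ifs <;> simp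

theorem sum_coef_smul_dualElt (x : D.CrossedProduct) :
    ∑ g, D.coef (eval k g) x • D.dualElt g = x := by
  induction x using D.crossed_induction with
  | zero => simp
  | add x y hx hy => simp only [map_add, add_smul, Finset.sum_add_distrib, hx, hy]
  | elt a h =>
    conv_rhs => rw [← sum_eval_smul_p h, map_sum]
    refine Finset.sum_congr rfl fun g _ => ?_
    rw [coef_elt, map_smul, elt_eq_smul, smul_assoc]
    rfl

/-- The translation `a # f ↦ a # f(· s)`, so that `a # p_g ↦ a # p_{g s⁻¹}`. -/
def shift (s : G) : D.CrossedProduct →+ D.CrossedProduct where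
  toFun x := ∑ g, D.coef (eval k g) x • D.dualElt (g * s⁻¹)
  map_zero' := by simp
  map_add' x y := by simp only [map_add, add_smul, Finset.sum_add_distrib]

theorem shift_apply (s : G) (x : D.CrossedProduct) :
    D.shift s x = ∑ g, D.coef (eval k g) x • D.dualElt (g * s⁻¹) := rfl

theorem shift_smul (s : G) (r : R) (x : D.CrossedProduct) :
    D.shift s (r • x) = r • D.shift s x := by
  simp only [shift_apply, coef_smul, mul_smul, Finset.smul_sum]

theorem shift_dualElt (s g : G) : D.shift s (D.dualElt g) = D.dualElt (g * s⁻¹) := by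
  rw [← one_smul R (D.dualElt g)]
  simp [shift_apply, coef_smul_dualElt, ite_smul, -one_smul]
  simp

theorem shift_one (s : G) : D.shift s 1 = 1 := by
  rw [← sum_dualElt, map_sum]
  simp only [shift_dualElt]
  exact Equiv.sum_comp (Equiv.mulRight s⁻¹) D.dualElt

theorem shift_mul_dualElt (s h : G) (x : D.CrossedProduct) :
    D.shift s (x * D.dualElt h) = D.shift s x * D.shift s (D.dualElt h) := by
  rw [← D.sum_coef_smul_dualElt x]
  simp only [Finset.sum_mul, map_sum, smul_mul_assoc, shift_smul, shift_dualElt]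
  refine Finset.sum_congr rfl fun g _ => congrArg _ ?_
  rw [dualElt_mul, dualElt_mul, ← Equiv.sum_comp (Equiv.mulRight s), map_sum]
  refine Finset.sum_congr rfl fun t _ => ?_
  rw [shift_smul, shift_dualElt]
  simp [mul_assoc]

theorem shift_mul_incl (s : G) (b : R) (x : D.CrossedProduct) :
    D.shift s (x * D.incl b) = D.shift s x * D.incl b := by
  rw [← D.sum_coef_smul_dualElt x]
  simp only [Finset.sum_mul, map_sum, smul_mul_assoc, shift_smul, shift_dualElt,
    dualElt_mul_incl, mul_assoc]

theorem shift_mul (s : G) (x y : D.CrossedProduct) :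
    D.shift s (x * y) = D.shift s x * D.shift s y := by
  rw [← D.sum_coef_smul_dualElt y]
  simp only [Finset.mul_sum, map_sum]
  refine Finset.sum_congr rfl fun g _ => ?_
  rw [shift_smul, ← incl_mul, ← incl_mul, ← mul_assoc, ← mul_assoc, shift_mul_dualElt,
    shift_mul_incl]

/-- The action of `G` on the crossed product by the translations `shift`. -/
instance : MulSemiringAction G D.CrossedProduct where
  smul s x := D.shift s x
  one_smul x := by
    change D.shift 1 x = x
    simp only [shift_apply, inv_one, mul_one, sum_coef_smul_dualElt]
  mul_smul s t x := by
    change D.shift (s * t) x = D.shift s (D.shift t x)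
    rw [D.shift_apply t, map_sum, shift_apply]
    simp only [shift_smul, shift_dualElt, mul_inv_rev, mul_assoc]
  smul_zero s := map_zero _
  smul_add s := map_add _
  smul_one := D.shift_one
  smul_mul := D.shift_mul

theorem group_smul_def (s : G) (x : D.CrossedProduct) : s • x = D.shift s x := rfl

theorem smul_incl (s : G) (r : R) : s • D.incl r = D.incl r := by
  rw [group_smul_def, incl_eq_smul_one, shift_smul, shift_one]

theorem sum_smul_eq_incl (x : D.CrossedProduct) :
    ∑ s : G, s • x = D.incl (∑ g, D.coef (eval k g) x) := by
  simp only [group_smul_def, shift_apply]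
  rw [Finset.sum_comm, map_sum]
  refine Finset.sum_congr rfl fun g _ => ?_
  rw [incl_eq_smul_one, ← sum_dualElt, ← Finset.smul_sum]
  exact congrArg _ (Equiv.sum_comp ((Equiv.inv G).trans (Equiv.mulLeft g)) D.dualElt)

/-- The element `∑ σ⁻¹(S h₂, h₃) # S h₁` for `h = p_x`; as a function of `h` this is a left
convolution inverse of `h ↦ 1 # h`. -/
def galoisElt (x : G) : D.CrossedProduct :=
  ∑ w, ∑ y, D.σinv (p k y ⊗ₜ p k (w * x)) • D.dualElt (y⁻¹ * w)

/-- Since `1 # p_{x⁻¹ g}` is the translate of `1 # p_{x⁻¹}` by `g⁻¹`, the `galoisElt x` and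
`1 # p_{x⁻¹}` are Galois coordinates for the crossed product over `R`. -/
theorem sum_galoisElt_mul_dualElt (g : G) :
    ∑ x, D.galoisElt x * D.dualElt (x⁻¹ * g) = if g = 1 then 1 else 0 := by
  have h1 : ∀ w t : G, ∑ x, ∑ y, D.σinv (p k y ⊗ₜ p k (w * x)) *
      D.σ (p k (y⁻¹ * w * t⁻¹) ⊗ₜ p k (x⁻¹ * g * t⁻¹)) = if w = t ∧ g = 1 then 1 else 0 := by
    intro w t
    have h2 := D.sum_sigmaInv_mul_sigma (w * t⁻¹) (w * g * t⁻¹)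
    rw [Finset.sum_comm, ← Equiv.sum_comp (Equiv.mulLeft w)] at h2
    simp only [Equiv.coe_mulLeft, mul_inv_rev, mul_assoc, inv_mul_cancel_left] at h2 ⊢
    rw [h2]
    refine if_congr ?_ rfl rfl
    rw [mul_inv_eq_one]
    refine and_congr_right fun hwt => ?_
    subst hwt
    rw [← mul_assoc, conj_eq_one_iff]
  have h2 : ∑ x, D.galoisElt x * D.dualElt (x⁻¹ * g) =
      ∑ w, ∑ t, (∑ x, ∑ y, D.σinv (p k y ⊗ₜ p k (w * x)) *
        D.σ (p k (y⁻¹ * w * t⁻¹) ⊗ₜ p k (x⁻¹ * g * t⁻¹))) • D.dualElt t := by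
    simp only [galoisElt, Finset.sum_mul, smul_mul_assoc, dualElt_mul, Finset.smul_sum, smul_smul,
      Finset.sum_smul]
    rw [Finset.sum_comm]
    refine Finset.sum_congr rfl fun w _ => ?_
    conv_rhs => rw [Finset.sum_comm]
    exact Finset.sum_congr rfl fun x _ => Finset.sum_comm
  rw [h2]
  simp only [h1]
  by_cases hg : g = 1
  · simp [hg, ite_smul, sum_dualElt]
  · simp [hg]

/-- The Galois coordinates are dual bases for the trace form. -/
theorem sum_trace_mul_dualElt (y : D.CrossedProduct) :
    ∑ x, (∑ s : G, s • (y * D.galoisElt x)) * D.dualElt x⁻¹ = y := by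
  have h1 : ∀ s : G, ∑ x, (s • D.galoisElt x) * D.dualElt x⁻¹ = if s = 1 then 1 else 0 := by
    intro s
    have h2 := congrArg (s • ·) (D.sum_galoisElt_mul_dualElt s)
    simp only [Finset.smul_sum, smul_mul', smul_ite, smul_one, smul_zero] at h2
    rw [← h2]
    refine Finset.sum_congr rfl fun x _ => congrArg _ ?_
    rw [group_smul_def, shift_dualElt, mul_inv_cancel_right]
  simp only [smul_mul', Finset.sum_mul]
  rw [Finset.sum_comm]
  simp only [mul_assoc, ← Finset.mul_sum, h1]
  simp

theorem smul_mem_jacobson (s : G) {x : D.CrossedProduct}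
    (hx : x ∈ Ring.jacobson D.CrossedProduct) : s • x ∈ Ring.jacobson D.CrossedProduct := by
  have : RingHomSurjective (MulSemiringAction.toRingHom G D.CrossedProduct s) :=
    ⟨MulAction.surjective s⟩
  exact Ring.le_comap_jacobson (MulSemiringAction.toRingHom G D.CrossedProduct s) hx

/-- The coefficients `tr(y c_x)` of `y ∈ J(A)` lie in `J(A) ∩ R`, as `J(A)` is stable under `G`. This
inclusion does not need `|G|` to be invertible. -/
theorem jac_crossedProduct_le_of_dual :
    jac k D.CrossedProduct ≤ D.crossedSubspace (jac k R) := by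
  intro y hy
  rw [← D.sum_trace_mul_dualElt y]
  refine sum_mem fun x _ => ?_
  rw [sum_smul_eq_incl, incl_mul, dualElt, ← elt_eq_smul]
  refine D.elt_mem_crossedSubspace (D.comap_jacobson_le ?_) _
  rw [Ideal.mem_comap, ← sum_smul_eq_incl]
  exact sum_mem fun s _ => D.smul_mem_jacobson s (Ideal.mul_mem_right _ _ hy)

/-- For `x ∈ J(R) ⊆ J(A)` the coefficients of `(1 # p_g)(x # 1) ∈ J(A) ⊆ J(R) # H` lie in `J(R)`;
the one at `p_1` is `p_g · x`. -/
theorem act_p_mem_jac_of_mem_jac (hG : ((Fintype.card G : ℕ) : k) ≠ 0) (g : G) {x : R}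
    (hx : x ∈ jac k R) : D.act (p k g) x ∈ jac k R := by
  have h1 : D.incl x ∈ Ring.jacobson D.CrossedProduct :=
    jacobson_le_comap_of_fixed (G := G) hG D.incl D.smul_incl
      (fun a => ⟨_, D.sum_smul_eq_incl a⟩) hx
  have h2 := D.coef_mem_of_mem_crossedSubspace
    (D.jac_crossedProduct_le_of_dual (Ideal.mul_mem_left _ (D.dualElt g) h1)) (eval k 1)
  rw [dualElt_mul_incl, map_sum] at h2
  simpa [coef_smul_dualElt, eq_inv_mul_iff_mul_eq] using h2

theorem act_mem_jac_of_mem_jac_of_dual (hG : ((Fintype.card G : ℕ) : k) ≠ 0)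
    (h : GroupDual k G) (x : R) (hx : x ∈ jac k R) : D.act h x ∈ jac k R := by
  rw [← sum_eval_smul_p h, map_sum, LinearMap.sum_apply]
  refine sum_mem fun g _ => ?_
  rw [map_smul]
  exact Submodule.smul_mem _ _ (D.act_p_mem_jac_of_mem_jac hG g hx)

instance : Module.Finite k (GroupDual k G) := inferInstanceAs (Module.Finite k (G → k))

end GroupDual

end TwistedModuleAlgebra

end TwistedHopf

end

theorem theorem2p7 {k : Type*} [Field k] {G : Type*} [Group G] [Fintype G] [DecidableEq G]
    (hG : ((Fintype.card G : ℕ) : k) ≠ 0) {R : Type*} [Ring R] [Algebra k R] :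
    (∀ D : TwistedHopf.TwistedModuleAlgebra k (MonoidAlgebra k G) R,
      TwistedHopf.jac k R = D.hJacobson ∧ D.hJacobson = D.jacobsonH ∧
      (∀ (h : MonoidAlgebra k G), ∀ x ∈ TwistedHopf.jac k R, D.act h x ∈ TwistedHopf.jac k R) ∧
      TwistedHopf.jac k D.CrossedProduct = D.crossedSubspace D.hJacobson) ∧
    (∀ D : TwistedHopf.TwistedModuleAlgebra k (TwistedHopf.GroupDual k G) R,
      TwistedHopf.jac k R = D.hJacobson ∧ D.hJacobson = D.jacobsonH ∧
      (∀ (h : TwistedHopf.GroupDual k G), ∀ x ∈ TwistedHopf.jac k R,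
        D.act h x ∈ TwistedHopf.jac k R) ∧
      (∀ x ∈ TwistedHopf.jac k R,
        (∀ g : G, D.act (TwistedHopf.GroupDual.p k g) x ∈ TwistedHopf.jac k R) ∧
        ∑ g : G, D.act (TwistedHopf.GroupDual.p k g) x = x) ∧
      TwistedHopf.jac k D.CrossedProduct = D.crossedSubspace D.hJacobson) := by
  refine ⟨fun D => D.radicals_eq D.act_mem_jac_of_mem_jac (D.jac_crossedProduct_le hG),
    fun D => ?_⟩
  obtain ⟨h1, h2, h3, h4⟩ := D.radicals_eq (D.act_mem_jac_of_mem_jac_of_dual hG)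
    D.jac_crossedProduct_le_of_dual
  refine ⟨h1, h2, h3, fun x hx => ⟨fun g => h3 _ x hx, ?_⟩, h4⟩
  rw [← LinearMap.sum_apply, ← map_sum, TwistedHopf.GroupDual.sum_p, D.one_act]
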